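/- Let $\mu$ be a finite positive Borel measure on the unit circle $\mathbb T$ with infinite support. Let $\Phi_n(\cdot;\mu)$ and $\varphi_n(\cdot;\mu)$ $(n\ge 0)$ be its monic orthogonal polynomials and its orthonormal polynomials with positive leading coefficients. Put $K_n(z,w;\mu)=\sum_{j=0}^n\overline{\varphi_j(w;\mu)}\,\varphi_j(z;\mu)$. For a polynomial $q$ of degree $d$ let $q^*(z)=z^{d}\,\overline{q(1/\overline z)}$. Put $$\alpha_n(\mu)=-\overline{\Phi_{n+1}(0;\mu)},\qquad \tau_n(\mu)=\frac{\Phi_n(1;\mu)}{\Phi_n^*(1;\mu)}\qquad(n\ge0),$$ and, for $n\ge 1$, writing $\beta_n=\tau_{n-1}(\mu)\alpha_{n-1}(\mu)$, $$g_n(\mu)=\frac12\,\frac{|1-\beta_n|^2}{1-\operatorname{Re}\beta_n},\qquad c_n(\mu)=\frac{\operatorname{Im}\beta_n}{\operatorname{Re}\beta_n-1}.$$ Finally let $$\xi_n(\mu)=\mu(\mathbb T)\prod_{j=1}^n 2\bigl(1-g_j(\mu)\bigr),\qquad R_n(z;\mu)=\xi_n(\mu)\,K_n(z,1;\mu)\qquad(n\ge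 0).$$ Let $G_2$ be a self-reciprocal polynomial ($G_2^*=G_2$) of exact degree $2$ with two distinct zeros $z_1\ne z_2$, such that $G_2(\zeta)/\zeta\ge 0$ for every $\zeta\in\operatorname{supp}\mu$, and let $d\nu(\zeta)=\zeta^{-1}G_2(\zeta)\,d\mu(\zeta)$. The same quantities are defined for $\nu$. Then there are complex sequences $(\gamma_n)$, $(a_1^{(n)})$, $(a_2^{(n)})$, $n\ge 0$, such that $$\gamma_n\,G_2(z)R_n(z;\nu)=R_{n+2}(z;\mu)+a_1^{(n)}R_{n+1}(z;\mu)+a_2^{(n)}\,z\,R_n(z;\mu)\qquad (z\in\mathbb C,\ n\ge 0),$$ and any such sequences satisfy the following, where all denominators that occur are nonzero. For $n\ge 0$, $$a_1^{(n)}=-\frac{R_{n+2}(z_1;\mu)\,z_2R_n(z_2;\mu)-R_{n+2}(z_2;\mu)\,z_1R_n(z_1;\mu)}{R_{n+1}(z_1;\mu)\,z_2R_n(z_2;\mu)-R_{n+1}(z_2;\mu)\,z_1R_n(z_1;\mu)},$$ $$a_2^{(n)}=\frac{R_{n+2}(z_1;\mu)R_{n+1}(z_2;\mu)-R_{n+2}(z_2;\mu)R_{n+1}(z_1;\mu)}{R_{n+1}(z_1;\mu)\,z_2R_n(z_2;\mu)-R_{n+1}(z_2;\mu)\,z_1R_n(z_1;\mu)};$$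 $\gamma_0=[\overline{G_2(0)}]^{-1}[1+ic_1(\mu)][1+ic_2(\mu)]$; and for $n\ge 1$, $$\gamma_n=\frac12\left[[1-ic_{n+1}(\mu)]\frac{[1-ic_{n+2}(\mu)]+a_1^{(n)}}{[1-ic_{n+1}(\mu)]+a_1^{(n-1)}}+[1+ic_{n+2}(\mu)]\right]\gamma_{n-1},$$ $$c_n(\nu)=\frac i2\,\frac{\gamma_{n-1}}{\gamma_n}\left[[1-ic_{n+1}(\mu)]\frac{[1-ic_{n+2}(\mu)]+a_1^{(n)}}{[1-ic_{n+1}(\mu)]+a_1^{(n-1)}}-[1+ic_{n+2}(\mu)]\right],$$ $$g_n(\nu)=1-\frac12\,\frac{\gamma_{n-1}}{\gamma_n}\,\frac{\xi_{n+2}(\mu)+a_1^{(n)}\xi_{n+1}(\mu)+a_2^{(n)}\xi_n(\mu)}{\xi_{n+1}(\mu)+a_1^{(n-1)}\xi_n(\mu)+a_2^{(n-1)}\xi_{n-1}(\mu)}.$$ -/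

import Mathlib

open MeasureTheory Polynomial
open scoped ComplexConjugate ComplexOrder

namespace OPUC

/-- The sesquilinear form `∫ conj (p ζ) * q ζ dμ(ζ)` on polynomials. Measures on the unit circle
are measures on `ℂ` that give no mass to the complement of the unit circle. -/
noncomputable def form (μ : Measure ℂ) (p q : ℂ[X]) : ℂ :=
  ∫ ζ, conj (p.eval ζ) * q.eval ζ ∂μ

/-- The monic orthogonal polynomial `Φ_n(·; μ)`, by the Gram-Schmidt process
applied to `1, z, z², …`. -/
noncomputable def monic (μ : Measure ℂ) (n : ℕ) : ℂ[X] :=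
  X ^ n - ∑ k : Fin n,
    C (form μ (monic μ k) (X ^ n) / form μ (monic μ k) (monic μ k)) * monic μ k
termination_by n
decreasing_by all_goals exact k.2

/-- The leading coefficient `κ_n(μ)` of the orthonormal polynomial of degree `n`. -/
noncomputable def kappa (μ : Measure ℂ) (n : ℕ) : ℝ :=
  (Real.sqrt (∫ ζ, ‖(monic μ n).eval ζ‖ ^ 2 ∂μ))⁻¹

/-- The orthonormal polynomial `φ_n(·; μ)` with positive leading coefficient. -/
noncomputable def orthonormal (μ : Measure ℂ) (n : ℕ) : ℂ[X] :=
  C (kappa μ n : ℂ) * monic μ n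

/-- The Christoffel-Darboux kernel `K_n(z, w; μ)`. -/
noncomputable def cdKernel (μ : Measure ℂ) (n : ℕ) (z w : ℂ) : ℂ :=
  ∑ j ∈ Finset.range (n + 1), conj ((orthonormal μ j).eval w) * (orthonormal μ j).eval z

/-- The reversed (conjugate-reciprocal) polynomial `q*(z) = z ^ deg q * conj (q (1 / conj z))`,
i.e. conjugate the coefficients and reverse their order. -/
noncomputable def star (q : ℂ[X]) : ℂ[X] := (q.map (starRingEnd ℂ)).reverse

/-- The Verblunsky coefficients `α_n(μ) = - conj (Φ_{n+1}(0; μ))`. -/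
noncomputable def verblunsky (μ : Measure ℂ) (n : ℕ) : ℂ := - conj ((monic μ (n + 1)).eval 0)

/-- `τ_n(μ) = Φ_n(1; μ) / Φ_n*(1; μ)`. -/
noncomputable def tau (μ : Measure ℂ) (n : ℕ) : ℂ :=
  (monic μ n).eval 1 / (star (monic μ n)).eval 1

/-- The parameters `g_n(μ)`, meaningful for `n ≥ 1`. -/
noncomputable def g (μ : Measure ℂ) (n : ℕ) : ℝ :=
  1 / 2 * (‖1 - tau μ (n - 1) * verblunsky μ (n - 1)‖ ^ 2 /
    (1 - (tau μ (n - 1) * verblunsky μ (n - 1)).re))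

/-- The parameters `c_n(μ)`, meaningful for `n ≥ 1`. -/
noncomputable def c (μ : Measure ℂ) (n : ℕ) : ℝ :=
  (tau μ (n - 1) * verblunsky μ (n - 1)).im /
    ((tau μ (n - 1) * verblunsky μ (n - 1)).re - 1)

/-- The normalization constants `ξ_n(μ) = μ(𝕋) ∏_{j=1}^n 2 (1 - g_j(μ))`. The factors `2` are the
ones for which `R_n = ξ_n K_n(·, 1)` obeys the recurrence
`R_{n+1} = ((1 + i c_{n+1}) z + (1 - i c_{n+1})) R_n - 4 (1 - g_n) g_{n+1} z R_{n-1}`, `R_0 = 1`. -/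
noncomputable def xi (μ : Measure ℂ) (n : ℕ) : ℝ :=
  μ.real Set.univ * ∏ j ∈ Finset.Icc 1 n, (2 * (1 - g μ j))

/-- The normalized Christoffel-Darboux kernels `R_n(z; μ) = ξ_n(μ) K_n(z, 1; μ)`. -/
noncomputable def R (μ : Measure ℂ) (n : ℕ) (z : ℂ) : ℂ := (xi μ n : ℂ) * cdKernel μ n z 1

/-- The measure `dν(ζ) = ζ⁻¹ G(ζ) dμ(ζ)`, for `G` with `ζ⁻¹ G(ζ) ≥ 0` on the support of `μ`. -/
noncomputable def christoffel (G : ℂ[X]) (μ : Measure ℂ) : Measure ℂ :=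
  μ.withDensity fun ζ => ENNReal.ofReal (G.eval ζ / ζ).re

/-- `γ_n, a_1^{(n)}, a_2^{(n)}` are coefficients of the connection formula
`γ_n G(z) R_n(z; ν) = R_{n+2}(z; μ) + a_1^{(n)} R_{n+1}(z; μ) + a_2^{(n)} z R_n(z; μ)`, where
`dν(ζ) = ζ⁻¹ G(ζ) dμ(ζ)`. -/
def IsConnection (μ : Measure ℂ) (G : ℂ[X]) (γ a₁ a₂ : ℕ → ℂ) : Prop :=
  ∀ (n : ℕ) (z : ℂ), γ n * G.eval z * R (christoffel G μ) n z =
    R μ (n + 2) z + a₁ n * R μ (n + 1) z + a₂ n * z * R μ n z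

end OPUC

/-!
Everything follows from a reproducing property. The kernel `K_n(z, 1)`, as a polynomial in `z`,
satisfies `⟨p, K_n(·, 1)⟩ = conj (p 1)` for `deg p ≤ n` (`form_kernelPoly`), and up to a factor
it is the only polynomial of degree at most `n` orthogonal to all `(z - 1) q` with `deg q < n`
(`exists_eq_C_mul_rPoly`). On the circle `⟨p, q⟩_ν = ⟨z p, G q⟩_μ` (`form_christoffel`), so
`G R_n(·; ν)` has degree at most `n + 2` and is `μ`-orthogonal to all `z (z - 1) q` with
`deg q < n`. The polynomials with these two properties form a space of dimension three, spanned by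
`R_{n+2}`, `R_{n+1}` and `z R_n` (`exists_eq_rPoly_add`); this is the connection formula.

The Szegő recursion (`monic_succ`) evaluated at `1`, with the resulting relation between norms
(`normSq_succ_beta`), gives `∏ (1 + i c_k)` for the leading coefficient of `R_n` and `∏ (1 - i c_k)`
for its constant term (`coeff_rPoly_succ`, `eval_zero_rPoly_succ`). Comparing leading coefficients,
constant terms, and inner products with `z` in the connection formula gives three families of
relations (`IsConnection.coeff_eq`, `IsConnection.eval_zero_eq`, `IsConnection.xi_eq`); the ratios of
consecutive members are equivalent to the formulas for `γ_n`, `c_n(ν)` and `g_n(ν)`, and show that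
the denominators in them do not vanish.

The formulas for `a₁` and `a₂` solve the linear system obtained by evaluation at the zeros of `G`.
Its determinant is nonzero (`det_ne_zero`) because a nontrivial combination of `R_{n+1}` and `z R_n`
divisible by `G` would produce a kernel of `ν` of too small a degree.
-/

namespace OPUC

/-! ### The sesquilinear form of a measure on the circle -/

/-- A nontrivial measure on the unit circle: finite, carried by the circle, and with a definite
form on polynomials. The last condition is the form in which infinite support is used. -/
structure IsNontrivial (μ : Measure ℂ) : Prop where
  finite : IsFiniteMeasure μ
  circle : μ (Metric.sphere (0 : ℂ) 1)ᶜ = 0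
  definite : ∀ p : ℂ[X], form μ p p = 0 → p = 0

theorem ae_norm_eq_one {μ : Measure ℂ} (h : μ (Metric.sphere (0 : ℂ) 1)ᶜ = 0) :
    ∀ᵐ ζ ∂μ, ‖ζ‖ = 1 := by
  rw [ae_iff]
  convert h using 2
  ext ζ
  simp

theorem integrable_of_continuous {E : Type*} [NormedAddCommGroup E] {μ : Measure ℂ}
    [IsFiniteMeasure μ] (h : μ (Metric.sphere (0 : ℂ) 1)ᶜ = 0) {f : ℂ → E} (hf : Continuous f) :
    Integrable f μ := by
  have h1 : μ.restrict (Metric.sphere (0 : ℂ) 1) = μ :=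
    Measure.restrict_eq_self_of_ae_mem (by
      filter_upwards [ae_norm_eq_one h] with ζ hζ
      simpa using hζ)
  rw [← h1]
  exact hf.continuousOn.integrableOn_compact (isCompact_sphere 0 1)

theorem conj_eq_inv_of_norm_eq_one {ζ : ℂ} (h : ‖ζ‖ = 1) : conj ζ = ζ⁻¹ := by
  rw [Complex.inv_def, Complex.normSq_eq_norm_sq, h]
  simp

theorem form_conj_symm (μ : Measure ℂ) (p q : ℂ[X]) : conj (form μ p q) = form μ q p := by
  unfold form
  rw [← integral_conj]
  congr 1
  ext ζ
  simp [mul_comm]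

theorem form_C_mul_right (μ : Measure ℂ) (a : ℂ) (p q : ℂ[X]) :
    form μ p (C a * q) = a * form μ p q := by
  unfold form
  rw [← integral_const_mul]
  congr 1
  ext ζ
  simp [mul_left_comm]

theorem form_C_mul_left (μ : Measure ℂ) (a : ℂ) (p q : ℂ[X]) :
    form μ (C a * p) q = conj a * form μ p q := by
  rw [← form_conj_symm, form_C_mul_right, map_mul, form_conj_symm]

theorem form_self (μ : Measure ℂ) (p : ℂ[X]) :
    form μ p p = ((∫ ζ, ‖p.eval ζ‖ ^ 2 ∂μ : ℝ) : ℂ) := by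
  unfold form
  rw [← integral_complex_ofReal]
  congr 1
  ext ζ
  rw [Complex.conj_mul']
  simp

theorem form_zero_left (μ : Measure ℂ) (q : ℂ[X]) : form μ 0 q = 0 := by simp [form]

theorem form_zero_right (μ : Measure ℂ) (q : ℂ[X]) : form μ q 0 = 0 := by simp [form]

namespace IsNontrivial

variable {μ : Measure ℂ}

theorem integrable (h : IsNontrivial μ) (p q : ℂ[X]) :
    Integrable (fun ζ => conj (p.eval ζ) * q.eval ζ) μ :=
  haveI := h.finite
  integrable_of_continuous h.circle
    ((Complex.continuous_conj.comp p.continuous).mul q.continuous)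

theorem form_add_right (h : IsNontrivial μ) (p q r : ℂ[X]) :
    form μ p (q + r) = form μ p q + form μ p r := by
  unfold form
  rw [← integral_add (h.integrable p q) (h.integrable p r)]
  congr 1
  ext ζ
  simp [mul_add]

theorem form_sub_right (h : IsNontrivial μ) (p q r : ℂ[X]) :
    form μ p (q - r) = form μ p q - form μ p r := by
  unfold form
  rw [← integral_sub (h.integrable p q) (h.integrable p r)]
  congr 1
  ext ζ
  simp [mul_sub]

theorem form_add_left (h : IsNontrivial μ) (p q r : ℂ[X]) :
    form μ (p + q) r = form μ p r + form μ q r := by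
  rw [← form_conj_symm, h.form_add_right, map_add, form_conj_symm, form_conj_symm]

theorem form_sub_left (h : IsNontrivial μ) (p q r : ℂ[X]) :
    form μ (p - q) r = form μ p r - form μ q r := by
  rw [← form_conj_symm, h.form_sub_right, map_sub, form_conj_symm, form_conj_symm]

theorem form_sum_right (h : IsNontrivial μ) {ι : Type*} (s : Finset ι) (p : ℂ[X])
    (q : ι → ℂ[X]) : form μ p (∑ i ∈ s, q i) = ∑ i ∈ s, form μ p (q i) := by
  classical
  induction s using Finset.induction_on with
  | empty => simp [form_zero_right]
  | insert i s hi ih => rw [Finset.sum_insert hi, Finset.sum_insert hi, h.form_add_right, ih]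

theorem form_X_mul_X_mul (h : IsNontrivial μ) (p q : ℂ[X]) :
    form μ (X * p) (X * q) = form μ p q := by
  unfold form
  refine integral_congr_ae ?_
  filter_upwards [ae_norm_eq_one h.circle] with ζ hζ
  have h1 : conj ζ * ζ = 1 := by rw [Complex.conj_mul', hζ]; simp
  simp only [eval_mul, eval_X, map_mul]
  linear_combination (conj (eval ζ p) * eval ζ q) * h1

end IsNontrivial

/-! ### Monic orthogonal polynomials -/

/-- The squared norm of the monic orthogonal polynomial `Φ_n`. -/
noncomputable def normSq (μ : Measure ℂ) (n : ℕ) : ℝ := ∫ ζ, ‖(monic μ n).eval ζ‖ ^ 2 ∂μ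

theorem form_monic_self (μ : Measure ℂ) (n : ℕ) :
    form μ (monic μ n) (monic μ n) = (normSq μ n : ℂ) := form_self μ _

theorem monic_eq (μ : Measure ℂ) (n : ℕ) :
    monic μ n = X ^ n - ∑ k : Fin n,
      C (form μ (monic μ k) (X ^ n) / form μ (monic μ k) (monic μ k)) * monic μ k := by
  rw [monic]

theorem monic_spec (μ : Measure ℂ) (n : ℕ) :
    (monic μ n).Monic ∧ (monic μ n).natDegree = n := by
  induction n using Nat.strong_induction_on with
  | _ n ih =>
    have hd : (∑ k : Fin n, C (form μ (monic μ k) (X ^ n) / form μ (monic μ k) (monic μ k)) *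
        monic μ k).degree < (n : WithBot ℕ) := by
      rw [degree_lt_iff_coeff_zero]
      intro m hm
      rw [finsetSum_coeff]
      refine Finset.sum_eq_zero fun k _ => ?_
      rw [coeff_C_mul, coeff_eq_zero_of_natDegree_lt, mul_zero]
      rw [(ih k k.2).2]
      omega
    rw [monic]
    refine ⟨monic_X_pow_sub hd, natDegree_eq_of_degree_eq_some ?_⟩
    rw [degree_sub_eq_left_of_degree_lt (by rwa [degree_X_pow]), degree_X_pow]

theorem monic_monic (μ : Measure ℂ) (n : ℕ) : (monic μ n).Monic := (monic_spec μ n).1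

theorem natDegree_monic (μ : Measure ℂ) (n : ℕ) : (monic μ n).natDegree = n := (monic_spec μ n).2

theorem degree_monic (μ : Measure ℂ) (n : ℕ) : (monic μ n).degree = n := by
  rw [degree_eq_natDegree (monic_monic μ n).ne_zero, natDegree_monic]

theorem coeff_monic_self (μ : Measure ℂ) (n : ℕ) : (monic μ n).coeff n = 1 := by
  have := (monic_monic μ n).coeff_natDegree
  rwa [natDegree_monic] at this

theorem degree_monic_lt {μ : Measure ℂ} {k n : ℕ} (h : k < n) :
    (monic μ k).degree < (n : WithBot ℕ) := by
  rw [degree_monic]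
  exact_mod_cast h

/-- Subtracting the top term, taken as a multiple of `Φ_n`, lowers the degree. -/
theorem degree_sub_monic_lt (μ : Measure ℂ) {n : ℕ} {p : ℂ[X]}
    (hp : p.degree < ((n + 1 : ℕ) : WithBot ℕ)) :
    (p - C (p.coeff n) * monic μ n).degree < (n : WithBot ℕ) := by
  rw [degree_lt_iff_coeff_zero] at hp ⊢
  intro m hm
  rcases hm.eq_or_lt with rfl | hm
  · simp [coeff_monic_self]
  · rw [coeff_sub, hp m hm, coeff_C_mul, (degree_lt_iff_coeff_zero _ _).1
      (degree_monic_lt hm) m le_rfl]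
    simp

namespace IsNontrivial

variable {μ : Measure ℂ}

theorem normSq_ne_zero (h : IsNontrivial μ) (n : ℕ) : (normSq μ n : ℂ) ≠ 0 := by
  rw [← form_monic_self]
  exact fun h0 => (monic_monic μ n).ne_zero (h.definite _ h0)

theorem normSq_pos (h : IsNontrivial μ) (n : ℕ) : 0 < normSq μ n := by
  refine lt_of_le_of_ne (integral_nonneg fun ζ => by positivity) fun h0 => ?_
  exact h.normSq_ne_zero n (by simp [← h0])

theorem form_monic_of_lt (h : IsNontrivial μ) {k n : ℕ} (hk : k < n) :
    form μ (monic μ k) (monic μ n) = 0 := by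
  induction n using Nat.strong_induction_on generalizing k with
  | _ n ih =>
    rw [monic_eq μ n, h.form_sub_right, h.form_sum_right, Finset.sum_eq_single ⟨k, hk⟩]
    · rw [form_C_mul_right, div_mul_cancel₀, sub_self]
      rw [form_monic_self]
      exact h.normSq_ne_zero k
    · intro j _ hj
      rw [form_C_mul_right]
      rcases lt_trichotomy k j with hkj | hkj | hkj
      · rw [ih j j.2 hkj, mul_zero]
      · exact absurd (Fin.ext hkj.symm) hj
      · rw [← form_conj_symm μ (monic μ j) (monic μ k), ih k hk hkj, map_zero, mul_zero]
    · simp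

theorem form_monic_of_degree_lt (h : IsNontrivial μ) {n : ℕ} {p : ℂ[X]}
    (hp : p.degree < (n : WithBot ℕ)) : form μ p (monic μ n) = 0 := by
  suffices H : ∀ k ≤ n, ∀ p : ℂ[X], p.degree < (k : WithBot ℕ) → form μ p (monic μ n) = 0 from
    H n le_rfl p hp
  intro k
  induction k with
  | zero =>
    intro _ p hp
    have : p = 0 := by simpa [degree_lt_iff_coeff_zero, Polynomial.ext_iff] using hp
    rw [this, form_zero_left]
  | succ k ih =>
    intro hk p hp
    have h1 := ih (by omega) _ (degree_sub_monic_lt μ hp)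
    rwa [h.form_sub_left, form_C_mul_left, h.form_monic_of_lt (by omega), mul_zero,
      sub_zero] at h1

theorem form_monic (h : IsNontrivial μ) {n : ℕ} {p : ℂ[X]}
    (hp : p.degree < ((n + 1 : ℕ) : WithBot ℕ)) :
    form μ p (monic μ n) = conj (p.coeff n) * normSq μ n := by
  have h1 := h.form_monic_of_degree_lt (degree_sub_monic_lt μ hp)
  rw [h.form_sub_left, form_C_mul_left, form_monic_self] at h1
  exact sub_eq_zero.1 h1

end IsNontrivial

/-! ### Reversed polynomials and the Szegő recursion -/

/-- The reversal `z ^ n * conj (p (1 / conj z))` of a polynomial `p` of degree at most `n`. -/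
noncomputable def recip (n : ℕ) (p : ℂ[X]) : ℂ[X] := reflect n (p.map (starRingEnd ℂ))

theorem star_eq_recip (p : ℂ[X]) : star p = recip p.natDegree p := by
  rw [star, recip, reverse, natDegree_map]

theorem coeff_recip (n : ℕ) (p : ℂ[X]) (m : ℕ) :
    (recip n p).coeff m = conj (p.coeff (revAt n m)) := by
  rw [recip, coeff_reflect, coeff_map]

theorem degree_recip_lt {n : ℕ} {p : ℂ[X]} (hp : p.degree < ((n + 1 : ℕ) : WithBot ℕ)) :
    (recip n p).degree < ((n + 1 : ℕ) : WithBot ℕ) := by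
  rw [degree_lt_iff_coeff_zero] at hp ⊢
  intro m hm
  rw [coeff_recip, revAt_eq_self_of_lt (by omega), hp m hm, map_zero]

theorem eval_recip {n : ℕ} {p : ℂ[X]} (hp : p.degree < ((n + 1 : ℕ) : WithBot ℕ)) {ζ : ℂ}
    (hζ : ‖ζ‖ = 1) : (recip n p).eval ζ = ζ ^ n * conj (p.eval ζ) := by
  have h0 : ζ ≠ 0 := by
    rintro rfl
    simp at hζ
  have hn : p.natDegree ≤ n := by
    rcases eq_or_ne p 0 with rfl | h
    · simp
    · rw [degree_eq_natDegree h] at hp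
      have : p.natDegree < n + 1 := by exact_mod_cast hp
      omega
  let _ : Invertible ζ⁻¹ := invertibleOfNonzero (inv_ne_zero h0)
  have h1 := eval₂_reflect_mul_pow (RingHom.id ℂ) ζ⁻¹ n (p.map (starRingEnd ℂ))
    (by rwa [natDegree_map])
  rw [invOf_eq_inv, inv_inv] at h1
  have h2 : conj (p.eval ζ) = eval₂ (RingHom.id ℂ) ζ⁻¹ (p.map (starRingEnd ℂ)) := by
    rw [← conj_eq_inv_of_norm_eq_one hζ, ← eval, eval_map, eval₂_hom]
  rw [h2, ← h1, inv_pow, recip, ← eval]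
  field_simp

theorem eval_star_one (p : ℂ[X]) : (star p).eval 1 = conj (p.eval 1) := by
  have hp : p.degree < ((p.natDegree + 1 : ℕ) : WithBot ℕ) :=
    degree_le_natDegree.trans_lt (by exact_mod_cast p.natDegree.lt_succ_self)
  rw [star_eq_recip, eval_recip hp (by simp)]
  simp

theorem degree_star_monic_lt (μ : Measure ℂ) (n : ℕ) :
    (star (monic μ n)).degree < ((n + 1 : ℕ) : WithBot ℕ) := by
  rw [star_eq_recip, natDegree_monic]
  exact degree_recip_lt (degree_monic_lt n.lt_succ_self)

theorem eval_zero_star_monic (μ : Measure ℂ) (n : ℕ) : (star (monic μ n)).eval 0 = 1 := by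
  rw [star_eq_recip, natDegree_monic, ← coeff_zero_eq_eval_zero, coeff_recip]
  simp [coeff_monic_self]

namespace IsNontrivial

variable {μ : Measure ℂ}

/-- On the circle both integrands equal `ζ ^ n * conj (p ζ) * conj (q ζ)`. -/
theorem form_recip (h : IsNontrivial μ) {n : ℕ} {p q : ℂ[X]}
    (hp : p.degree < ((n + 1 : ℕ) : WithBot ℕ)) (hq : q.degree < ((n + 1 : ℕ) : WithBot ℕ)) :
    form μ p (recip n q) = form μ q (recip n p) := by
  refine integral_congr_ae ?_
  filter_upwards [ae_norm_eq_one h.circle] with ζ hζ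
  rw [eval_recip hp hζ, eval_recip hq hζ]
  ring

/-- `Φ_n*` represents, up to a factor, evaluation at `0` on polynomials of degree at most `n`. -/
theorem form_star_monic (h : IsNontrivial μ) {n : ℕ} {p : ℂ[X]}
    (hp : p.degree < ((n + 1 : ℕ) : WithBot ℕ)) :
    form μ p (star (monic μ n)) = conj (p.eval 0) * normSq μ n := by
  rw [star_eq_recip, natDegree_monic, h.form_recip hp (degree_monic_lt n.lt_succ_self),
    ← form_conj_symm, h.form_monic (degree_recip_lt hp), coeff_recip]
  simp [coeff_zero_eq_eval_zero]

theorem form_star_monic_self (h : IsNontrivial μ) (n : ℕ) :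
    form μ (star (monic μ n)) (star (monic μ n)) = normSq μ n := by
  rw [h.form_star_monic (degree_star_monic_lt μ n), eval_zero_star_monic]
  simp

/-- The Szegő recursion. The difference of the two sides has degree at most `n` and no constant
term, and its form with itself vanishes because each of its three summands is orthogonal to it. -/
theorem monic_succ (h : IsNontrivial μ) (n : ℕ) :
    monic μ (n + 1) = X * monic μ n - C (conj (verblunsky μ n)) * star (monic μ n) := by
  set S := star (monic μ n) with hS
  set a := (monic μ (n + 1)).eval 0 with ha
  set T := monic μ (n + 1) - X * monic μ n - C a * S with hT
  have hdeg : T.degree < ((n + 1 : ℕ) : WithBot ℕ) := by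
    have hSd := degree_star_monic_lt μ n
    rw [← hS] at hSd
    rw [degree_lt_iff_coeff_zero] at hSd ⊢
    intro m hm
    obtain ⟨m, rfl⟩ : ∃ k, m = k + 1 := ⟨m - 1, by omega⟩
    rw [hT, coeff_sub, coeff_sub, coeff_C_mul, hSd _ hm, coeff_X_mul]
    rcases (show n ≤ m by omega).eq_or_lt with rfl | hlt
    · simp [coeff_monic_self]
    · rw [coeff_eq_zero_of_natDegree_lt (by rw [natDegree_monic]; omega),
        coeff_eq_zero_of_natDegree_lt (by rw [natDegree_monic]; omega)]
      simp
  have hT0 : T.eval 0 = 0 := by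
    simp [hT, hS, eval_zero_star_monic, ← ha]
  obtain ⟨q, hq⟩ : X ∣ T := by rwa [X_dvd_iff, coeff_zero_eq_eval_zero]
  have hqd : q.degree < (n : WithBot ℕ) := by
    rw [degree_lt_iff_coeff_zero] at hdeg ⊢
    intro m hm
    have := hdeg (m + 1) (by omega)
    rwa [hq, coeff_X_mul] at this
  have hform : form μ T T = 0 := by
    conv_lhs => rw [hT]
    rw [← hT, h.form_sub_right, h.form_sub_right, h.form_monic_of_degree_lt hdeg,
      form_C_mul_right, h.form_star_monic hdeg, hT0, hq, h.form_X_mul_X_mul,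
      h.form_monic_of_degree_lt hqd]
    simp
  have h1 := h.definite T hform
  have h2 : conj (verblunsky μ n) = -a := by simp [verblunsky, ha]
  rw [h2, C_neg, ← sub_eq_zero, ← h1, hT]
  ring

/-- Pythagoras for the Szegő recursion, in which `Φ_{n+1}` and `Φ_n*` are orthogonal. -/
theorem normSq_succ (h : IsNontrivial μ) (n : ℕ) :
    normSq μ (n + 1) = normSq μ n * (1 - ‖verblunsky μ n‖ ^ 2) := by
  have h1 : form μ (X * monic μ n) (X * monic μ n) = normSq μ n := by
    rw [h.form_X_mul_X_mul, form_monic_self]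
  have h2 : X * monic μ n =
      monic μ (n + 1) + C (conj (verblunsky μ n)) * star (monic μ n) := by
    rw [h.monic_succ n]
    ring
  have h3 := h.form_monic_of_degree_lt (degree_star_monic_lt μ n)
  have h4 : form μ (monic μ (n + 1)) (star (monic μ n)) = 0 := by
    rw [← form_conj_symm, h3, map_zero]
  rw [h2, h.form_add_right, h.form_add_left, h.form_add_left, form_C_mul_left, form_C_mul_right,
    form_C_mul_right, form_C_mul_left, form_monic_self, h.form_star_monic_self, h3, h4,
    Complex.conj_conj] at h1
  have h5 : conj (verblunsky μ n) * verblunsky μ n = ((‖verblunsky μ n‖ ^ 2 : ℝ) : ℂ) := by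
    rw [Complex.conj_mul']
    simp
  have h6 : (normSq μ (n + 1) : ℂ) =
      ((normSq μ n * (1 - ‖verblunsky μ n‖ ^ 2) : ℝ) : ℂ) := by
    push_cast at h5 ⊢
    linear_combination h1 - (normSq μ n : ℂ) * h5
  exact_mod_cast h6

theorem norm_verblunsky_lt_one (h : IsNontrivial μ) (n : ℕ) : ‖verblunsky μ n‖ < 1 := by
  have h1 := h.normSq_pos (n + 1)
  rw [h.normSq_succ, mul_pos_iff_of_pos_left (h.normSq_pos n)] at h1
  have h2 := norm_nonneg (verblunsky μ n)
  nlinarith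

/-- The orthogonal polynomials have no zero at `1`. If `Φ_n = (z - 1) q`, then `q` is orthogonal to
`Φ_n`, and Pythagoras for `z q = Φ_n + q` contradicts `‖z q‖ = ‖q‖`. -/
theorem eval_one_monic_ne_zero (h : IsNontrivial μ) (n : ℕ) : (monic μ n).eval 1 ≠ 0 := by
  intro h0
  obtain ⟨q, hq⟩ := dvd_iff_isRoot.2 h0
  have hq0 : q ≠ 0 := by
    rintro rfl
    exact (monic_monic μ n).ne_zero (by simpa using hq)
  have hqd : q.degree < (n : WithBot ℕ) := by
    have h1 := degree_monic μ n
    rw [hq, degree_mul, degree_X_sub_C, degree_eq_natDegree hq0] at h1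
    rw [degree_eq_natDegree hq0]
    have h2 : 1 + q.natDegree = n := by exact_mod_cast h1
    exact_mod_cast (by omega : q.natDegree < n)
  have h1 : X * q = monic μ n + q := by
    rw [hq, C_1]
    ring
  have h2 := h.form_X_mul_X_mul q q
  have h3 := h.form_monic_of_degree_lt hqd
  have h4 : form μ (monic μ n) q = 0 := by rw [← form_conj_symm, h3, map_zero]
  rw [h1, h.form_add_right, h.form_add_left, h.form_add_left, h3, h4, form_monic_self] at h2
  exact h.normSq_ne_zero n (by linear_combination h2)

end IsNontrivial

/-! ### The kernel `K_n(z, 1)` as a polynomial in `z` -/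

/-- The polynomial whose value at `z` is the Christoffel-Darboux kernel `K_n(z, 1)`. -/
noncomputable def kernelPoly (μ : Measure ℂ) (n : ℕ) : ℂ[X] :=
  ∑ j ∈ Finset.range (n + 1), C (conj ((orthonormal μ j).eval 1)) * orthonormal μ j

theorem eval_kernelPoly (μ : Measure ℂ) (n : ℕ) (z : ℂ) :
    (kernelPoly μ n).eval z = cdKernel μ n z 1 := by
  simp [kernelPoly, cdKernel, eval_finsetSum]

theorem conj_orthonormal_mul (μ : Measure ℂ) (n : ℕ) :
    C (conj ((orthonormal μ n).eval 1)) * orthonormal μ n =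
      C (conj ((monic μ n).eval 1) / normSq μ n) * monic μ n := by
  have h1 : (kappa μ n : ℂ) * kappa μ n = (normSq μ n : ℂ)⁻¹ := by
    have h0 : 0 ≤ normSq μ n := integral_nonneg fun ζ => by positivity
    have : kappa μ n * kappa μ n = (normSq μ n)⁻¹ := by
      rw [kappa, ← mul_inv]
      congr 1
      exact Real.mul_self_sqrt h0
    exact_mod_cast this
  rw [orthonormal, eval_mul, eval_C, map_mul, Complex.conj_ofReal, ← mul_assoc, ← C_mul,
    div_eq_mul_inv, ← h1]
  congr 2
  ring

theorem kernelPoly_zero (μ : Measure ℂ) :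
    kernelPoly μ 0 = C (conj ((monic μ 0).eval 1) / normSq μ 0) * monic μ 0 := by
  simp [kernelPoly, conj_orthonormal_mul]

theorem kernelPoly_succ (μ : Measure ℂ) (n : ℕ) :
    kernelPoly μ (n + 1) = kernelPoly μ n +
      C (conj ((monic μ (n + 1)).eval 1) / normSq μ (n + 1)) * monic μ (n + 1) := by
  rw [kernelPoly, Finset.sum_range_succ, conj_orthonormal_mul, ← kernelPoly]

theorem degree_kernelPoly_lt (μ : Measure ℂ) (n : ℕ) :
    (kernelPoly μ n).degree < ((n + 1 : ℕ) : WithBot ℕ) := by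
  rw [degree_lt_iff_coeff_zero]
  intro m hm
  rw [kernelPoly, finsetSum_coeff]
  refine Finset.sum_eq_zero fun j hj => ?_
  rw [conj_orthonormal_mul, coeff_C_mul, (degree_lt_iff_coeff_zero _ _).1
    (degree_monic_lt (lt_of_lt_of_le (Finset.mem_range.1 hj) hm)) m le_rfl, mul_zero]

theorem coeff_kernelPoly_self (μ : Measure ℂ) (n : ℕ) :
    (kernelPoly μ n).coeff n = conj ((monic μ n).eval 1) / normSq μ n := by
  cases n with
  | zero => rw [kernelPoly_zero, coeff_C_mul, coeff_monic_self, mul_one]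
  | succ n =>
    rw [kernelPoly_succ, coeff_add, coeff_C_mul, coeff_monic_self, mul_one,
      (degree_lt_iff_coeff_zero _ _).1 (degree_kernelPoly_lt μ n) _ le_rfl, zero_add]

/-- The parameter `β_{n+1} = τ_n α_n`. -/
noncomputable def beta (μ : Measure ℂ) (n : ℕ) : ℂ := tau μ n * verblunsky μ n

/-- The polynomial whose value at `z` is `R_n(z)`. -/
noncomputable def rPoly (μ : Measure ℂ) (n : ℕ) : ℂ[X] := C (xi μ n : ℂ) * kernelPoly μ n

theorem eval_rPoly (μ : Measure ℂ) (n : ℕ) (z : ℂ) : (rPoly μ n).eval z = R μ n z := by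
  rw [rPoly, eval_mul, eval_C, eval_kernelPoly, R]

theorem degree_rPoly_lt (μ : Measure ℂ) (n : ℕ) :
    (rPoly μ n).degree < ((n + 1 : ℕ) : WithBot ℕ) := by
  have h1 := degree_kernelPoly_lt μ n
  rw [degree_lt_iff_coeff_zero] at h1 ⊢
  intro m hm
  rw [rPoly, coeff_C_mul, h1 m hm, mul_zero]

theorem coeff_rPoly_self (μ : Measure ℂ) (n : ℕ) : (rPoly μ n).coeff n =
    (xi μ n / normSq μ n : ℝ) * conj ((monic μ n).eval 1) := by
  rw [rPoly, coeff_C_mul, coeff_kernelPoly_self]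
  push_cast
  ring

theorem monic_zero (μ : Measure ℂ) : monic μ 0 = 1 := by
  rw [monic_eq]
  simp

theorem normSq_zero (μ : Measure ℂ) : normSq μ 0 = μ.real Set.univ := by
  simp [normSq, monic_zero]

theorem xi_zero (μ : Measure ℂ) : xi μ 0 = normSq μ 0 := by
  simp [xi, normSq_zero]

theorem one_add_I_mul_ofReal_ne_zero (x : ℝ) : 1 + Complex.I * x ≠ 0 := by
  intro h
  simpa using congrArg Complex.re h

namespace IsNontrivial

variable {μ : Measure ℂ}

/-- The reproducing property of the kernel. -/
theorem form_kernelPoly (h : IsNontrivial μ) {n : ℕ} {p : ℂ[X]}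
    (hp : p.degree < ((n + 1 : ℕ) : WithBot ℕ)) :
    form μ p (kernelPoly μ n) = conj (p.eval 1) := by
  induction n generalizing p with
  | zero =>
    have h0 := h.normSq_ne_zero 0
    have h1 : p = C (p.coeff 0) := by
      refine eq_C_of_degree_le_zero ?_
      rw [← Nat.WithBot.lt_one_iff_le_zero]
      exact_mod_cast hp
    rw [kernelPoly_zero, form_C_mul_right, h.form_monic hp, h1]
    simp only [monic_zero, eval_one, map_one, coeff_C_zero, eval_C]
    field_simp
  | succ n ih =>
    have h0 := h.normSq_ne_zero (n + 1)
    have h1 := degree_sub_monic_lt μ hp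
    have h2 := ih h1
    have h3 : form μ (monic μ (n + 1)) (kernelPoly μ n) = 0 := by
      rw [← form_conj_symm, h.form_monic_of_degree_lt (degree_kernelPoly_lt μ n), map_zero]
    rw [h.form_sub_left, form_C_mul_left, h3, eval_sub, eval_mul, eval_C, map_sub, map_mul] at h2
    rw [kernelPoly_succ, h.form_add_right, form_C_mul_right, h.form_monic hp]
    field_simp
    linear_combination h2

/-- The value at `0` comes from pairing the kernel, which reproduces at `1`, with `Φ_n*`, which
reproduces at `0`. -/
theorem eval_zero_kernelPoly (h : IsNontrivial μ) (n : ℕ) :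
    (kernelPoly μ n).eval 0 = (monic μ n).eval 1 / normSq μ n := by
  have h1 := h.form_star_monic (degree_kernelPoly_lt μ n)
  have h2 := h.form_kernelPoly (degree_star_monic_lt μ n)
  rw [← form_conj_symm, h2, eval_star_one] at h1
  have h3 := congrArg conj h1
  simp only [Complex.conj_conj, map_mul, Complex.conj_ofReal] at h3
  rw [eq_div_iff (h.normSq_ne_zero n), ← h3]

/-! ### The parameters `c_n`, `g_n` and the end coefficients of `R_n` -/

theorem norm_beta_lt_one (h : IsNontrivial μ) (n : ℕ) : ‖beta μ n‖ < 1 := by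
  have h0 := norm_ne_zero_iff.2 (h.eval_one_monic_ne_zero n)
  rw [beta, tau, eval_star_one, norm_mul, norm_div, RCLike.norm_conj, div_self h0, one_mul]
  exact h.norm_verblunsky_lt_one n

theorem normSq_succ_beta (h : IsNontrivial μ) (n : ℕ) :
    normSq μ (n + 1) = normSq μ n * (1 - ‖beta μ n‖ ^ 2) := by
  have h0 := norm_ne_zero_iff.2 (h.eval_one_monic_ne_zero n)
  rw [h.normSq_succ, beta, tau, eval_star_one, norm_mul, norm_div, RCLike.norm_conj,
    div_self h0, one_mul]

theorem conj_eval_one_monic_succ (h : IsNontrivial μ) (n : ℕ) :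
    conj ((monic μ (n + 1)).eval 1) = conj ((monic μ n).eval 1) * (1 - beta μ n) := by
  have h0 : conj ((monic μ n).eval 1) ≠ 0 := by
    simpa using h.eval_one_monic_ne_zero n
  rw [h.monic_succ, beta, tau, eval_sub, eval_mul, eval_mul, eval_X, eval_C, eval_star_one,
    map_sub, map_mul, map_mul, Complex.conj_conj, Complex.conj_conj, map_one]
  field_simp

theorem beta_re_lt_one (h : IsNontrivial μ) (n : ℕ) : (beta μ n).re < 1 :=
  lt_of_le_of_lt ((le_abs_self _).trans (Complex.abs_re_le_norm _)) (h.norm_beta_lt_one n)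

theorem xi_succ (h : IsNontrivial μ) (n : ℕ) :
    xi μ (n + 1) = xi μ n * ((1 - ‖beta μ n‖ ^ 2) / (1 - (beta μ n).re)) := by
  have h1 : 1 - (beta μ n).re ≠ 0 := (sub_pos.2 (h.beta_re_lt_one n)).ne'
  rw [xi, Finset.prod_Icc_succ_top (by omega), ← mul_assoc, ← xi, g, Nat.add_sub_cancel, ← beta]
  congr 1
  rw [← Complex.normSq_eq_norm_sq, ← Complex.normSq_eq_norm_sq, Complex.normSq_apply,
    Complex.normSq_apply]
  simp only [Complex.sub_re, Complex.sub_im, Complex.one_re, Complex.one_im]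
  field_simp
  ring

theorem xi_ne_zero (h : IsNontrivial μ) (n : ℕ) : xi μ n ≠ 0 := by
  induction n with
  | zero =>
    rw [xi_zero]
    exact (h.normSq_pos 0).ne'
  | succ n ih =>
    have h1 := h.norm_beta_lt_one n
    have h2 := norm_nonneg (beta μ n)
    rw [h.xi_succ]
    refine mul_ne_zero ih (div_ne_zero ?_ (sub_pos.2 (h.beta_re_lt_one n)).ne')
    nlinarith

theorem one_sub_beta_div (h : IsNontrivial μ) (n : ℕ) :
    (1 - beta μ n) / (1 - (beta μ n).re : ℝ) = 1 + Complex.I * c μ (n + 1) := by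
  have h1 : ((1 - (beta μ n).re : ℝ) : ℂ) ≠ 0 := by
    exact_mod_cast (sub_pos.2 (h.beta_re_lt_one n)).ne'
  have h2 : (c μ (n + 1) : ℂ) = -((beta μ n).im / (1 - (beta μ n).re : ℝ)) := by
    rw [c, Nat.add_sub_cancel, ← beta, ← neg_sub, div_neg]
    push_cast
    rfl
  have h3 := Complex.re_add_im (beta μ n)
  rw [h2]
  field_simp
  push_cast
  linear_combination h3

theorem xi_div_normSq_succ (h : IsNontrivial μ) (n : ℕ) :
    xi μ (n + 1) / normSq μ (n + 1) = xi μ n / normSq μ n / (1 - (beta μ n).re) := by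
  have h1 := h.norm_beta_lt_one n
  have h2 := norm_nonneg (beta μ n)
  have h3 : 1 - ‖beta μ n‖ ^ 2 ≠ 0 := by nlinarith
  have h4 := (h.normSq_pos n).ne'
  have h5 : 1 - (beta μ n).re ≠ 0 := (sub_pos.2 (h.beta_re_lt_one n)).ne'
  rw [h.xi_succ, h.normSq_succ_beta]
  field_simp

theorem eval_zero_rPoly (h : IsNontrivial μ) (n : ℕ) :
    (rPoly μ n).eval 0 = conj ((rPoly μ n).coeff n) := by
  rw [coeff_rPoly_self, rPoly, eval_mul, eval_C, h.eval_zero_kernelPoly, map_mul,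
    Complex.conj_conj, Complex.conj_ofReal]
  push_cast
  ring

theorem coeff_rPoly_zero (h : IsNontrivial μ) : (rPoly μ 0).coeff 0 = 1 := by
  rw [coeff_rPoly_self, xi_zero, div_self (h.normSq_pos 0).ne', monic_zero]
  simp

theorem coeff_rPoly_succ (h : IsNontrivial μ) (n : ℕ) :
    (rPoly μ (n + 1)).coeff (n + 1) =
      (rPoly μ n).coeff n * (1 + Complex.I * c μ (n + 1)) := by
  rw [coeff_rPoly_self, coeff_rPoly_self, h.xi_div_normSq_succ, h.conj_eval_one_monic_succ,
    ← h.one_sub_beta_div]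
  push_cast
  ring

theorem eval_zero_rPoly_succ (h : IsNontrivial μ) (n : ℕ) :
    (rPoly μ (n + 1)).eval 0 = (rPoly μ n).eval 0 * (1 - Complex.I * c μ (n + 1)) := by
  rw [h.eval_zero_rPoly, h.eval_zero_rPoly, h.coeff_rPoly_succ]
  simp [sub_eq_add_neg]

theorem coeff_rPoly_ne_zero (h : IsNontrivial μ) (n : ℕ) : (rPoly μ n).coeff n ≠ 0 := by
  induction n with
  | zero =>
    rw [h.coeff_rPoly_zero]
    exact one_ne_zero
  | succ n ih =>
    rw [h.coeff_rPoly_succ]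
    exact mul_ne_zero ih (one_add_I_mul_ofReal_ne_zero _)

theorem eval_zero_rPoly_ne_zero (h : IsNontrivial μ) (n : ℕ) : (rPoly μ n).eval 0 ≠ 0 := by
  rw [h.eval_zero_rPoly]
  simpa using h.coeff_rPoly_ne_zero n

theorem form_rPoly (h : IsNontrivial μ) {n : ℕ} {p : ℂ[X]}
    (hp : p.degree < ((n + 1 : ℕ) : WithBot ℕ)) :
    form μ p (rPoly μ n) = xi μ n * conj (p.eval 1) := by
  rw [rPoly, form_C_mul_right, h.form_kernelPoly hp]

end IsNontrivial

/-! ### The spans that carry the connection formula -/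

theorem degree_X_sub_one_mul_lt {n : ℕ} {q : ℂ[X]} (hq : q.degree < (n : WithBot ℕ)) :
    ((X - 1) * q).degree < ((n + 1 : ℕ) : WithBot ℕ) := by
  rcases eq_or_ne q 0 with rfl | hq0
  · simp
  rw [← C_1, degree_mul, degree_X_sub_C, degree_eq_natDegree hq0]
  rw [degree_eq_natDegree hq0] at hq
  have : q.natDegree < n := by exact_mod_cast hq
  exact_mod_cast (by omega : 1 + q.natDegree < n + 1)

theorem degree_X_mul_lt {n : ℕ} {p : ℂ[X]} (hp : p.degree < (n : WithBot ℕ)) :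
    (X * p).degree < ((n + 1 : ℕ) : WithBot ℕ) := by
  rw [degree_lt_iff_coeff_zero] at hp ⊢
  intro m hm
  obtain ⟨m, rfl⟩ : ∃ j, m = j + 1 := ⟨m - 1, by omega⟩
  rw [coeff_X_mul, hp m (by omega)]

namespace IsNontrivial

variable {μ : Measure ℂ}

/-- A polynomial of degree at most `n` orthogonal to all `(z - 1) q`, `deg q < n`, is a multiple of
`R_n`, since its form against `p` only depends on `p(1)`. -/
theorem exists_eq_C_mul_rPoly (h : IsNontrivial μ) {n : ℕ} {p : ℂ[X]}
    (hp : p.degree < ((n + 1 : ℕ) : WithBot ℕ))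
    (horth : ∀ q : ℂ[X], q.degree < (n : WithBot ℕ) → form μ ((X - 1) * q) p = 0) :
    ∃ a : ℂ, p = C a * rPoly μ n := by
  have hxi : (xi μ n : ℂ) ≠ 0 := by exact_mod_cast h.xi_ne_zero n
  refine ⟨form μ 1 p / xi μ n, ?_⟩
  -- split `r = r(1) + (z - 1) q` and use orthogonality to the second summand
  have key : ∀ r : ℂ[X], r.degree < ((n + 1 : ℕ) : WithBot ℕ) →
      form μ r p = conj (r.eval 1) * form μ 1 p := by
    intro r hr
    obtain ⟨q, hq⟩ := X_sub_C_dvd_sub_C_eval (a := (1 : ℂ)) (p := r)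
    have hrq : r = C (r.eval 1) * 1 + (X - 1) * q := by
      rw [C_1] at hq
      rw [← hq]
      ring
    have hqd : q.degree < (n : WithBot ℕ) := by
      rcases eq_or_ne q 0 with rfl | hq0
      · simp
      have h1 : (r - C (r.eval 1)).degree < ((n + 1 : ℕ) : WithBot ℕ) := by
        refine (degree_sub_le _ _).trans_lt (max_lt hr (degree_C_le.trans_lt ?_))
        exact_mod_cast n.succ_pos
      rw [hq, degree_mul, degree_X_sub_C, degree_eq_natDegree hq0] at h1
      rw [degree_eq_natDegree hq0]
      have h2 : 1 + q.natDegree < n + 1 := by exact_mod_cast h1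
      exact_mod_cast (by omega : q.natDegree < n)
    conv_lhs => rw [hrq]
    rw [h.form_add_left, form_C_mul_left, horth q hqd, add_zero]
  set d := p - C (form μ 1 p / xi μ n) * rPoly μ n with hd
  have hdd : d.degree < ((n + 1 : ℕ) : WithBot ℕ) := by
    have h1 := degree_rPoly_lt μ n
    rw [degree_lt_iff_coeff_zero] at h1 hp ⊢
    intro m hm
    rw [hd, coeff_sub, coeff_C_mul, h1 m hm, hp m hm, mul_zero, sub_zero]
  refine sub_eq_zero.1 (h.definite d ?_)
  conv_lhs => rw [hd]
  rw [← hd, h.form_sub_right, form_C_mul_right, key d hdd, h.form_rPoly hdd]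
  field_simp
  ring

/-- `R_{n+2}`, `R_{n+1}` and `z R_n` span the polynomials of degree at most `n + 2` orthogonal to
all `z (z - 1) q`, `deg q < n`. -/
theorem exists_eq_rPoly_add (h : IsNontrivial μ) {n : ℕ} {p : ℂ[X]}
    (hp : p.degree < ((n + 3 : ℕ) : WithBot ℕ))
    (horth : ∀ q : ℂ[X], q.degree < (n : WithBot ℕ) → form μ (X * ((X - 1) * q)) p = 0) :
    ∃ a b e : ℂ, p = C a * rPoly μ (n + 2) + C b * rPoly μ (n + 1) + C e * X * rPoly μ n := by
  have hlead := h.coeff_rPoly_ne_zero (n + 2)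
  have hzero := h.eval_zero_rPoly_ne_zero (n + 1)
  -- `a` removes the coefficient of `z ^ (n + 2)`, `b` the constant term; what is left is `z t` with
  -- `deg t ≤ n`, and `t` is orthogonal to all `(z - 1) q`
  set a := p.coeff (n + 2) / (rPoly μ (n + 2)).coeff (n + 2) with ha
  set b := (p - C a * rPoly μ (n + 2)).eval 0 / (rPoly μ (n + 1)).eval 0 with hb
  set s := p - C a * rPoly μ (n + 2) - C b * rPoly μ (n + 1) with hs
  have hsd : s.degree < ((n + 2 : ℕ) : WithBot ℕ) := by
    have h1 := degree_rPoly_lt μ (n + 1)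
    have h2 := degree_rPoly_lt μ (n + 2)
    rw [degree_lt_iff_coeff_zero] at h1 h2 hp ⊢
    intro m hm
    rw [hs, coeff_sub, coeff_sub, coeff_C_mul, coeff_C_mul, h1 m hm, mul_zero, sub_zero]
    rcases hm.eq_or_lt with rfl | hlt
    · rw [ha, div_mul_cancel₀ _ hlead, sub_self]
    · rw [h2 m (by omega), hp m (by omega), mul_zero, sub_zero]
  have hs0 : s.eval 0 = 0 := by
    rw [hs, eval_sub, eval_mul, eval_C, hb, div_mul_cancel₀ _ hzero, sub_self]
  obtain ⟨t, ht⟩ : X ∣ s := by rwa [X_dvd_iff, coeff_zero_eq_eval_zero]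
  have htd : t.degree < ((n + 1 : ℕ) : WithBot ℕ) := by
    rw [degree_lt_iff_coeff_zero] at hsd ⊢
    intro m hm
    have := hsd (m + 1) (by omega)
    rwa [ht, coeff_X_mul] at this
  obtain ⟨e, he⟩ := h.exists_eq_C_mul_rPoly htd fun q hq => by
    have hX := degree_X_mul_lt (degree_X_sub_one_mul_lt hq)
    rw [← h.form_X_mul_X_mul, ← ht, hs, h.form_sub_right, h.form_sub_right, horth q hq,
      form_C_mul_right, form_C_mul_right, h.form_rPoly hX,
      h.form_rPoly (hX.trans (by exact_mod_cast (n + 2).lt_succ_self))]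
    simp
  refine ⟨a, b, e, ?_⟩
  have h3 : p = s + C a * rPoly μ (n + 2) + C b * rPoly μ (n + 1) := by
    rw [hs]
    ring
  rw [h3, ht, he]
  ring

/-- `R_{n+1}` and `z R_n` are linearly independent: the first has a nonzero constant term, and the
second has none. -/
theorem eq_zero_of_rPoly_add_eq_zero (h : IsNontrivial μ) {n : ℕ} {b e : ℂ}
    (hbe : C b * rPoly μ (n + 1) + C e * X * rPoly μ n = 0) : b = 0 ∧ e = 0 := by
  have h1 := congrArg (eval 0) hbe
  simp only [eval_add, eval_mul, eval_C, eval_X, mul_zero, zero_mul, add_zero, eval_zero] at h1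
  have hb := (mul_eq_zero.1 h1).resolve_right (h.eval_zero_rPoly_ne_zero (n + 1))
  refine ⟨hb, ?_⟩
  have h2 := congrArg (coeff · (n + 1)) hbe
  simp only [hb, C_0, zero_mul, zero_add, mul_assoc, coeff_C_mul, coeff_X_mul, coeff_zero] at h2
  exact (mul_eq_zero.1 h2).resolve_right (h.coeff_rPoly_ne_zero n)

/-! ### Nontriviality of `μ` and `ν` -/

theorem of_infinite_support [IsFiniteMeasure μ] (hμT : μ (Metric.sphere (0 : ℂ) 1)ᶜ = 0)
    (hμ : μ.support.Infinite) : IsNontrivial μ where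
  finite := inferInstance
  circle := hμT
  definite p hp := by
    rw [form_self] at hp
    have h1 : ∫ ζ, ‖p.eval ζ‖ ^ 2 ∂μ = 0 := by exact_mod_cast hp
    have hint : Integrable (fun ζ => ‖p.eval ζ‖ ^ 2) μ :=
      integrable_of_continuous hμT (p.continuous.norm.pow 2)
    rw [integral_eq_zero_iff_of_nonneg (fun ζ => by positivity) hint] at h1
    have hcl : IsClosed {ζ : ℂ | p.eval ζ = 0} := isClosed_eq p.continuous continuous_const
    have hsub : μ.support ⊆ {ζ : ℂ | p.eval ζ = 0} := by
      refine Measure.support_subset_of_isClosed hcl ?_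
      filter_upwards [h1] with ζ hζ
      simpa using hζ
    exact eq_zero_of_infinite_isRoot p (hμ.mono hsub)

variable {G : ℂ[X]}

theorem christoffel_circle (h : IsNontrivial μ) :
    christoffel G μ (Metric.sphere (0 : ℂ) 1)ᶜ = 0 :=
  withDensity_absolutelyContinuous _ _ h.circle

theorem form_christoffel (h : IsNontrivial μ) (hpos : ∀ ζ ∈ μ.support, 0 ≤ G.eval ζ / ζ)
    (p q : ℂ[X]) : form (christoffel G μ) p q = form μ (X * p) (G * q) := by
  have hm : Measurable fun ζ : ℂ => Real.toNNReal (G.eval ζ / ζ).re := by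
    have : Measurable fun ζ : ℂ => G.eval ζ := G.continuous.measurable
    fun_prop
  unfold form christoffel
  have h0 := integral_withDensity_eq_integral_smul hm (μ := μ)
    (fun ζ => conj (p.eval ζ) * q.eval ζ)
  refine h0.trans (integral_congr_ae ?_)
  filter_upwards [ae_norm_eq_one h.circle, Measure.support_mem_ae] with ζ hζ hs
  have h1 := hpos ζ hs
  rw [Complex.le_def] at h1
  have h2 : (((G.eval ζ / ζ).re : ℝ) : ℂ) = G.eval ζ * conj ζ := by
    rw [conj_eq_inv_of_norm_eq_one hζ, ← div_eq_mul_inv]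
    exact Complex.ext rfl h1.2
  rw [NNReal.smul_def, Real.coe_toNNReal _ h1.1, Complex.real_smul, h2]
  simp only [eval_mul, eval_X, map_mul]
  ring

/-- `ν` is nontrivial: if `p` has `ν`-norm zero, then `G p` vanishes `μ`-almost everywhere, hence is
the zero polynomial. -/
theorem christoffel (h : IsNontrivial μ) (hG : G ≠ 0)
    (hpos : ∀ ζ ∈ μ.support, 0 ≤ G.eval ζ / ζ) : IsNontrivial (christoffel G μ) where
  finite := by
    have := h.finite
    refine isFiniteMeasure_withDensity_ofReal (Integrable.hasFiniteIntegral ?_)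
    refine (integrable_of_continuous h.circle
      (Complex.continuous_re.comp (G.continuous.mul Complex.continuous_conj))).congr ?_
    filter_upwards [ae_norm_eq_one h.circle] with ζ hζ
    simp only [Function.comp, Pi.mul_apply, conj_eq_inv_of_norm_eq_one hζ, div_eq_mul_inv]
  circle := h.christoffel_circle
  definite p hp := by
    rw [h.form_christoffel hpos] at hp
    have hint := h.integrable (X * p) (G * p)
    have hnn : ∀ᵐ ζ ∂μ, conj ((X * p).eval ζ) * (G * p).eval ζ =
        (((G.eval ζ / ζ).re * ‖p.eval ζ‖ ^ 2 : ℝ) : ℂ) ∧ 0 ≤ (G.eval ζ / ζ).re ∧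
          G.eval ζ = (G.eval ζ / ζ).re * ζ := by
      filter_upwards [ae_norm_eq_one h.circle, Measure.support_mem_ae] with ζ hζ hs
      have h1 := hpos ζ hs
      rw [Complex.le_def] at h1
      have h2 : (((G.eval ζ / ζ).re : ℝ) : ℂ) = G.eval ζ / ζ := Complex.ext rfl h1.2
      have h3 : ζ ≠ 0 := by
        rintro rfl
        simp at hζ
      refine ⟨?_, h1.1, by rw [h2, div_mul_cancel₀ _ h3]⟩
      push_cast
      rw [h2, ← Complex.conj_mul', div_eq_mul_inv, ← conj_eq_inv_of_norm_eq_one hζ]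
      simp only [eval_mul, eval_X, map_mul]
      ring
    have h1 : ∫ ζ, (G.eval ζ / ζ).re * ‖p.eval ζ‖ ^ 2 ∂μ = 0 := by
      rw [form, integral_congr_ae (hnn.mono fun ζ hζ => hζ.1), integral_complex_ofReal] at hp
      exact_mod_cast hp
    have hint' : Integrable (fun ζ => (G.eval ζ / ζ).re * ‖p.eval ζ‖ ^ 2) μ := by
      refine hint.re.congr (hnn.mono fun ζ hζ => ?_)
      simp only [hζ.1]
      exact Complex.ofReal_re _
    rw [integral_eq_zero_iff_of_nonneg_ae
      (hnn.mono fun ζ hζ => mul_nonneg hζ.2.1 (by positivity)) hint'] at h1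
    have hGp : G * p = 0 := by
      refine h.definite _ ?_
      rw [form, ← integral_zero ℂ ℂ (μ := μ)]
      refine integral_congr_ae ?_
      filter_upwards [hnn, h1] with ζ h2 h3
      have h4 : (G * p).eval ζ = 0 := by
        rw [eval_mul, h2.2.2]
        rcases mul_eq_zero.1 h3 with h5 | h5
        · rw [h5]
          simp
        · have : p.eval ζ = 0 := by simpa using h5
          rw [this, mul_zero]
      rw [h4, mul_zero]
    exact (mul_eq_zero.1 hGp).resolve_left hG

end IsNontrivial

/-! ### The connection formula -/

variable {μ : Measure ℂ} {G : ℂ[X]}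

theorem coeff_two_ne_zero (hdeg : G.natDegree = 2) : G.coeff 2 ≠ 0 := by
  have h0 : G ≠ 0 := by
    rintro rfl
    simp at hdeg
  have := leadingCoeff_ne_zero.2 h0
  rwa [leadingCoeff, hdeg] at this

theorem conj_eval_zero_of_star_eq (hdeg : G.natDegree = 2) (hself : star G = G) :
    conj (G.eval 0) = G.coeff 2 := by
  have h1 := congrArg (coeff · 0) hself
  simp only [star_eq_recip, hdeg, coeff_recip] at h1
  rw [← coeff_zero_eq_eval_zero, ← h1]
  simp

theorem coeff_mul_rPoly (hdeg : G.natDegree = 2) (ν : Measure ℂ) (n : ℕ) :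
    (G * rPoly ν n).coeff (n + 2) = G.coeff 2 * (rPoly ν n).coeff n := by
  rw [add_comm n 2]
  refine coeff_mul_add_eq_of_natDegree_le hdeg.le ?_
  rw [natDegree_le_iff_coeff_eq_zero]
  exact fun m hm => (degree_lt_iff_coeff_zero _ _).1 (degree_rPoly_lt ν n) m hm

theorem coeff_rPoly_combination (n : ℕ) (a b e : ℂ) :
    (C a * rPoly μ (n + 2) + C b * rPoly μ (n + 1) + C e * X * rPoly μ n).coeff (n + 2) =
      a * (rPoly μ (n + 2)).coeff (n + 2) := by
  have h1 := (degree_lt_iff_coeff_zero _ _).1 (degree_rPoly_lt μ (n + 1)) (n + 2) le_rfl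
  have h2 := (degree_lt_iff_coeff_zero _ _).1 (degree_rPoly_lt μ n) (n + 1) le_rfl
  rw [coeff_add, coeff_add, mul_assoc, coeff_C_mul, coeff_C_mul, coeff_C_mul, coeff_X_mul, h1, h2]
  ring

theorem form_X_sub_one_mul_rPoly (h : IsNontrivial μ) {n : ℕ} {q : ℂ[X]}
    (hq : q.degree < (n : WithBot ℕ)) : form μ ((X - 1) * q) (rPoly μ n) = 0 := by
  rw [h.form_rPoly (degree_X_sub_one_mul_lt hq)]
  simp

theorem exists_isConnection (h : IsNontrivial μ) (hdeg : G.natDegree = 2)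
    (hpos : ∀ ζ ∈ μ.support, 0 ≤ G.eval ζ / ζ) :
    ∃ γ a₁ a₂ : ℕ → ℂ, IsConnection μ G γ a₁ a₂ := by
  have hG2 := coeff_two_ne_zero hdeg
  have hG : G ≠ 0 := by
    rintro rfl
    simp at hG2
  have hν := h.christoffel hG hpos
  have key : ∀ n, ∃ γ a₁ a₂ : ℂ, ∀ z, γ * G.eval z * R (christoffel G μ) n z =
      R μ (n + 2) z + a₁ * R μ (n + 1) z + a₂ * z * R μ n z := by
    intro n
    have hd : (G * rPoly (christoffel G μ) n).degree < ((n + 3 : ℕ) : WithBot ℕ) := by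
      have h1 := degree_rPoly_lt (christoffel G μ) n
      rcases eq_or_ne (rPoly (christoffel G μ) n) 0 with h0 | h0
      · rw [h0, mul_zero, degree_zero]
        exact WithBot.bot_lt_coe _
      rw [degree_mul, degree_eq_natDegree hG, hdeg, degree_eq_natDegree h0]
      rw [degree_eq_natDegree h0] at h1
      have : (rPoly (christoffel G μ) n).natDegree < n + 1 := by exact_mod_cast h1
      exact_mod_cast (by omega : 2 + (rPoly (christoffel G μ) n).natDegree < n + 3)
    obtain ⟨a, b, e, hab⟩ := h.exists_eq_rPoly_add hd fun q hq => by
      rw [← h.form_christoffel hpos, form_X_sub_one_mul_rPoly hν hq]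
    have ha : a ≠ 0 := by
      rintro rfl
      have h1 := congrArg (coeff · (n + 2)) hab
      simp only [coeff_mul_rPoly hdeg, coeff_rPoly_combination, zero_mul] at h1
      exact mul_ne_zero hG2 (hν.coeff_rPoly_ne_zero n) h1
    refine ⟨a⁻¹, b / a, e / a, fun z => ?_⟩
    have h2 := congrArg (eval z) hab
    simp only [eval_add, eval_mul, eval_C, eval_X, eval_rPoly] at h2
    field_simp
    linear_combination h2
  choose γ a₁ a₂ hc using key
  exact ⟨γ, a₁, a₂, hc⟩

/-- The determinant of the linear system for `a₁, a₂` does not vanish: otherwise a nontrivial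
combination of `R_{n+1}` and `z R_n` would be `G p` with `deg p < n`, and `p` would be a multiple
of the kernel of `ν`, which has exact degree `n`. -/
theorem det_ne_zero (h : IsNontrivial μ) (hdeg : G.natDegree = 2)
    (hpos : ∀ ζ ∈ μ.support, 0 ≤ G.eval ζ / ζ) {z₁ z₂ : ℂ} (hz₁ : G.eval z₁ = 0)
    (hz₂ : G.eval z₂ = 0) (hne : z₁ ≠ z₂) (n : ℕ) :
    R μ (n + 1) z₁ * (z₂ * R μ n z₂) - R μ (n + 1) z₂ * (z₁ * R μ n z₁) ≠ 0 := by
  intro hD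
  have hG2 := coeff_two_ne_zero hdeg
  have hG : G ≠ 0 := by
    rintro rfl
    simp at hG2
  have hν := h.christoffel hG hpos
  obtain ⟨v, hv0, hv⟩ := Matrix.exists_mulVec_eq_zero_iff.2
    (show (!![R μ (n + 1) z₁, z₁ * R μ n z₁; R μ (n + 1) z₂, z₂ * R μ n z₂]).det = 0 by
      rw [Matrix.det_fin_two_of]
      linear_combination hD)
  have hv1 := congrFun hv 0
  have hv2 := congrFun hv 1
  simp [Matrix.mulVec, dotProduct, Fin.sum_univ_two] at hv1 hv2
  set t := C (v 0) * rPoly μ (n + 1) + C (v 1) * X * rPoly μ n with ht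
  have heval : ∀ z, t.eval z = R μ (n + 1) z * v 0 + z * R μ n z * v 1 := by
    intro z
    simp only [ht, eval_add, eval_mul, eval_C, eval_X, eval_rPoly]
    ring
  have hfac : ∀ s : ℂ[X], s.eval z₁ = 0 → s.eval z₂ = 0 → (X - C z₁) * (X - C z₂) ∣ s :=
    fun s h1 h2 => (isCoprime_X_sub_C_of_isUnit_sub (sub_ne_zero.2 hne).isUnit).mul_dvd
      (dvd_iff_isRoot.2 h1) (dvd_iff_isRoot.2 h2)
  obtain ⟨u, hu⟩ := hfac t (by rw [heval, hv1]) (by rw [heval, hv2])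
  obtain ⟨w, hw⟩ := hfac G hz₁ hz₂
  have hw0 : w.natDegree = 0 := by
    have h1 : w ≠ 0 := by
      rintro rfl
      exact hG (by simpa using hw)
    have h2 : ((X - C z₁) * (X - C z₂)).natDegree = 2 := by
      rw [natDegree_mul (X_sub_C_ne_zero _) (X_sub_C_ne_zero _), natDegree_X_sub_C,
        natDegree_X_sub_C]
    have h3 := congrArg natDegree hw
    rw [natDegree_mul (mul_ne_zero (X_sub_C_ne_zero _) (X_sub_C_ne_zero _)) h1, h2, hdeg] at h3
    omega
  obtain ⟨k, rfl⟩ := natDegree_eq_zero.1 hw0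
  have hk : k ≠ 0 := by
    rintro rfl
    exact hG (by simpa using hw)
  set p := C k⁻¹ * u with hp
  have htp : t = G * p := by
    have : C k * C k⁻¹ = (1 : ℂ[X]) := by rw [← C_mul, mul_inv_cancel₀ hk, C_1]
    rw [hu, hw, hp]
    linear_combination (-((X - C z₁) * (X - C z₂) * u)) * this
  have hpd : p.degree < (n : WithBot ℕ) := by
    rcases eq_or_ne p 0 with h0 | h0
    · rw [h0]
      simp
    have h1 : t.degree < ((n + 2 : ℕ) : WithBot ℕ) := by
      have h1 := degree_rPoly_lt μ (n + 1)
      have h2 := degree_rPoly_lt μ n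
      rw [degree_lt_iff_coeff_zero] at h1 h2 ⊢
      intro m hm
      obtain ⟨m, rfl⟩ : ∃ j, m = j + 1 := ⟨m - 1, by omega⟩
      rw [ht, coeff_add, mul_assoc, coeff_C_mul, coeff_C_mul, coeff_X_mul, h1 _ hm,
        h2 m (by omega)]
      simp
    rw [htp, degree_mul, degree_eq_natDegree hG, hdeg, degree_eq_natDegree h0] at h1
    rw [degree_eq_natDegree h0]
    have : 2 + p.natDegree < n + 2 := by exact_mod_cast h1
    exact_mod_cast (by omega : p.natDegree < n)
  obtain ⟨a, ha⟩ := hν.exists_eq_C_mul_rPoly (n := n) (p := p)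
    (hpd.trans (by exact_mod_cast n.lt_succ_self)) fun q hq => by
      rw [h.form_christoffel hpos, ← htp, ht, h.form_add_right, mul_assoc (C (v 1)),
        form_C_mul_right, form_C_mul_right, h.form_X_mul_X_mul, form_X_sub_one_mul_rPoly h hq,
        h.form_rPoly (degree_X_mul_lt (degree_X_sub_one_mul_lt hq))]
      simp
  have ha0 : a = 0 := by
    have h1 := congrArg (coeff · n) ha
    simp only [coeff_C_mul, (degree_lt_iff_coeff_zero _ _).1 hpd n le_rfl] at h1
    exact (mul_eq_zero.1 h1.symm).resolve_right (hν.coeff_rPoly_ne_zero n)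
  have ht0 : C (v 0) * rPoly μ (n + 1) + C (v 1) * X * rPoly μ n = 0 := by
    rw [← ht, htp, ha, ha0]
    simp
  obtain ⟨h1, h2⟩ := h.eq_zero_of_rPoly_add_eq_zero ht0
  exact hv0 (funext fun i => by fin_cases i <;> assumption)

namespace IsConnection

variable {γ a₁ a₂ : ℕ → ℂ}

theorem rPoly_eq (hc : IsConnection μ G γ a₁ a₂) (n : ℕ) :
    C (γ n) * (G * rPoly (christoffel G μ) n) =
      C 1 * rPoly μ (n + 2) + C (a₁ n) * rPoly μ (n + 1) + C (a₂ n) * X * rPoly μ n := by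
  refine Polynomial.funext fun z => ?_
  simp only [eval_add, eval_mul, eval_C, eval_X, eval_rPoly, one_mul, ← mul_assoc]
  exact hc n z

theorem coeff_eq (hc : IsConnection μ G γ a₁ a₂) (hdeg : G.natDegree = 2) (n : ℕ) :
    γ n * (G.coeff 2 * (rPoly (christoffel G μ) n).coeff n) =
      (rPoly μ (n + 2)).coeff (n + 2) := by
  have h1 := congrArg (coeff · (n + 2)) (hc.rPoly_eq n)
  simpa only [coeff_C_mul, coeff_mul_rPoly hdeg, coeff_rPoly_combination, one_mul] using h1

theorem eval_zero_eq (hc : IsConnection μ G γ a₁ a₂) (h : IsNontrivial μ) (n : ℕ) :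
    γ n * (G.eval 0 * (rPoly (christoffel G μ) n).eval 0) =
      (rPoly μ (n + 1)).eval 0 * (1 - Complex.I * c μ (n + 2) + a₁ n) := by
  have h1 := congrArg (eval 0) (hc.rPoly_eq n)
  simp only [eval_add, eval_mul, eval_C, eval_X, h.eval_zero_rPoly_succ (n + 1)] at h1
  linear_combination h1

/-- Pairing the connection formula with `z`, at which both sides reproduce the value `1`. -/
theorem xi_eq (hc : IsConnection μ G γ a₁ a₂) (h : IsNontrivial μ)
    (hν : IsNontrivial (christoffel G μ)) (hpos : ∀ ζ ∈ μ.support, 0 ≤ G.eval ζ / ζ) (n : ℕ) :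
    γ n * xi (christoffel G μ) n = xi μ (n + 2) + a₁ n * xi μ (n + 1) + a₂ n * xi μ n := by
  have h1 := congrArg (form μ (X * 1)) (hc.rPoly_eq n)
  have hX : ∀ k, (X * 1 : ℂ[X]).degree < ((k + 1 + 1 : ℕ) : WithBot ℕ) := by
    intro k
    rw [mul_one, degree_X]
    exact_mod_cast (by omega : 1 < k + 1 + 1)
  have h1' : (1 : ℂ[X]).degree < ((n + 1 : ℕ) : WithBot ℕ) := by
    rw [degree_one]
    exact_mod_cast n.succ_pos
  rw [form_C_mul_right, ← h.form_christoffel hpos, hν.form_rPoly h1', h.form_add_right,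
    h.form_add_right, mul_assoc (C (a₂ n)), form_C_mul_right, form_C_mul_right, form_C_mul_right,
    h.form_X_mul_X_mul, h.form_rPoly (hX (n + 1)), h.form_rPoly (hX n), h.form_rPoly h1'] at h1
  simpa using h1

end IsConnection

end OPUC

theorem mainTheorem7 (μ : Measure ℂ) [IsFiniteMeasure μ]
    (hμT : μ (Metric.sphere (0 : ℂ) 1)ᶜ = 0) (hμ : μ.support.Infinite)
    (G : ℂ[X]) (hdeg : G.natDegree = 2) (hself : OPUC.star G = G)
    (hpos : ∀ ζ ∈ μ.support, 0 ≤ G.eval ζ / ζ)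
    (z₁ z₂ : ℂ) (hz₁ : G.eval z₁ = 0) (hz₂ : G.eval z₂ = 0) (hne : z₁ ≠ z₂) :
    (∃ γ a₁ a₂ : ℕ → ℂ, OPUC.IsConnection μ G γ a₁ a₂) ∧
    ∀ γ a₁ a₂ : ℕ → ℂ, OPUC.IsConnection μ G γ a₁ a₂ →
      -- none of the denominators below vanishes
      ((∀ n, OPUC.R μ (n + 1) z₁ * (z₂ * OPUC.R μ n z₂)
          - OPUC.R μ (n + 1) z₂ * (z₁ * OPUC.R μ n z₁) ≠ 0) ∧
        conj (G.eval 0) ≠ 0 ∧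
        (∀ n, γ n ≠ 0) ∧
        (∀ n, 1 - Complex.I * OPUC.c μ (n + 2) + a₁ n ≠ 0) ∧
        (∀ n, (OPUC.xi μ (n + 2) : ℂ) + a₁ n * OPUC.xi μ (n + 1) + a₂ n * OPUC.xi μ n ≠ 0)) ∧
      (∀ n, a₁ n =
        - (OPUC.R μ (n + 2) z₁ * (z₂ * OPUC.R μ n z₂)
            - OPUC.R μ (n + 2) z₂ * (z₁ * OPUC.R μ n z₁)) /
          (OPUC.R μ (n + 1) z₁ * (z₂ * OPUC.R μ n z₂)
            - OPUC.R μ (n + 1) z₂ * (z₁ * OPUC.R μ n z₁))) ∧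
      (∀ n, a₂ n =
        (OPUC.R μ (n + 2) z₁ * OPUC.R μ (n + 1) z₂
            - OPUC.R μ (n + 2) z₂ * OPUC.R μ (n + 1) z₁) /
          (OPUC.R μ (n + 1) z₁ * (z₂ * OPUC.R μ n z₂)
            - OPUC.R μ (n + 1) z₂ * (z₁ * OPUC.R μ n z₁))) ∧
      γ 0 = (conj (G.eval 0))⁻¹ *
        ((1 + Complex.I * OPUC.c μ 1) * (1 + Complex.I * OPUC.c μ 2)) ∧
      (∀ n, 1 ≤ n → γ n = 1 / 2 *
        ((1 - Complex.I * OPUC.c μ (n + 1)) *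
            ((1 - Complex.I * OPUC.c μ (n + 2) + a₁ n) /
              (1 - Complex.I * OPUC.c μ (n + 1) + a₁ (n - 1)))
          + (1 + Complex.I * OPUC.c μ (n + 2))) * γ (n - 1)) ∧
      (∀ n, 1 ≤ n → (OPUC.c (OPUC.christoffel G μ) n : ℂ) =
        Complex.I / 2 * (γ (n - 1) / γ n) *
          ((1 - Complex.I * OPUC.c μ (n + 1)) *
              ((1 - Complex.I * OPUC.c μ (n + 2) + a₁ n) /
                (1 - Complex.I * OPUC.c μ (n + 1) + a₁ (n - 1)))
            - (1 + Complex.I * OPUC.c μ (n + 2)))) ∧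
      (∀ n, 1 ≤ n → (OPUC.g (OPUC.christoffel G μ) n : ℂ) =
        1 - 1 / 2 * (γ (n - 1) / γ n) *
          ((OPUC.xi μ (n + 2) + a₁ n * OPUC.xi μ (n + 1) + a₂ n * OPUC.xi μ n) /
            (OPUC.xi μ (n + 1) + a₁ (n - 1) * OPUC.xi μ n
              + a₂ (n - 1) * OPUC.xi μ (n - 1)))) := by
  have h := OPUC.IsNontrivial.of_infinite_support hμT hμ
  have hG2 := OPUC.coeff_two_ne_zero hdeg
  have hG : G ≠ 0 := by
    rintro rfl
    simp at hG2
  have hG0 := OPUC.conj_eval_zero_of_star_eq hdeg hself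
  have hG0' : G.eval 0 ≠ 0 := by
    intro h0
    rw [h0, map_zero] at hG0
    exact hG2 hG0.symm
  have hν := h.christoffel hG hpos
  refine ⟨OPUC.exists_isConnection h hdeg hpos, fun γ a₁ a₂ hc => ?_⟩
  have hdet := OPUC.det_ne_zero h hdeg hpos hz₁ hz₂ hne
  have hlead := hc.coeff_eq hdeg
  have hzero := hc.eval_zero_eq h
  have hxi := hc.xi_eq h hν hpos
  have hA := h.coeff_rPoly_ne_zero
  have hA' := hν.coeff_rPoly_ne_zero
  have hB := h.eval_zero_rPoly_ne_zero
  have hB' := hν.eval_zero_rPoly_ne_zero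
  have hγ : ∀ n, γ n ≠ 0 := by
    intro n h0
    have := hlead n
    rw [h0, zero_mul] at this
    exact hA _ this.symm
  have ha : ∀ n, 1 - Complex.I * OPUC.c μ (n + 2) + a₁ n ≠ 0 := by
    intro n h0
    have := hzero n
    rw [h0, mul_zero] at this
    exact mul_ne_zero (hγ n) (mul_ne_zero hG0' (hB' n)) this
  have hxi' : ∀ n, (OPUC.xi (OPUC.christoffel G μ) n : ℂ) ≠ 0 := fun n => by
    exact_mod_cast hν.xi_ne_zero n
  have hx : ∀ n, (OPUC.xi μ (n + 2) : ℂ) + a₁ n * OPUC.xi μ (n + 1) + a₂ n * OPUC.xi μ n ≠ 0 := by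
    intro n
    rw [← hxi n]
    exact mul_ne_zero (hγ n) (hxi' n)
  have hroot : ∀ z, G.eval z = 0 → ∀ n,
      OPUC.R μ (n + 2) z + a₁ n * OPUC.R μ (n + 1) z + a₂ n * z * OPUC.R μ n z = 0 := by
    intro z hz n
    rw [← hc n z, hz]
    ring
  -- the ratios of consecutive leading coefficients and of consecutive constant terms
  have hplus : ∀ m, γ (m + 1) * (1 + Complex.I * OPUC.c (OPUC.christoffel G μ) (m + 1)) =
      γ m * (1 + Complex.I * OPUC.c μ (m + 3)) := by
    intro m
    have h1 := hlead m
    have h2 := hlead (m + 1)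
    rw [hν.coeff_rPoly_succ, h.coeff_rPoly_succ (m + 2), ← h1] at h2
    refine mul_left_cancel₀ (mul_ne_zero hG2 (hA' m)) ?_
    linear_combination h2
  have hminus : ∀ m, γ (m + 1) * (1 - Complex.I * OPUC.c (OPUC.christoffel G μ) (m + 1)) =
      γ m * ((1 - Complex.I * OPUC.c μ (m + 2)) *
        ((1 - Complex.I * OPUC.c μ (m + 3) + a₁ (m + 1)) /
          (1 - Complex.I * OPUC.c μ (m + 2) + a₁ m))) := by
    intro m
    have h1 := hzero m
    have h2 := hzero (m + 1)
    rw [hν.eval_zero_rPoly_succ, h.eval_zero_rPoly_succ (m + 1)] at h2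
    have h3 := ha m
    rw [← mul_div_assoc, ← mul_div_assoc, eq_div_iff h3]
    refine mul_left_cancel₀ (mul_ne_zero (hB (m + 1)) (mul_ne_zero hG0' (hB' m))) ?_
    linear_combination (OPUC.rPoly μ (m + 1)).eval 0 *
        (1 - Complex.I * OPUC.c μ (m + 2) + a₁ m) * h2 -
      (OPUC.rPoly μ (m + 1)).eval 0 * (1 - Complex.I * OPUC.c μ (m + 2)) *
        (1 - Complex.I * OPUC.c μ (m + 3) + a₁ (m + 1)) * h1
  refine ⟨⟨hdet, by rwa [hG0], hγ, ha, hx⟩, ?_, ?_, ?_, ?_, ?_, ?_⟩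
  · intro n
    rw [eq_div_iff (hdet n)]
    linear_combination (z₂ * OPUC.R μ n z₂) * hroot z₁ hz₁ n -
      (z₁ * OPUC.R μ n z₁) * hroot z₂ hz₂ n
  · intro n
    rw [eq_div_iff (hdet n)]
    linear_combination OPUC.R μ (n + 1) z₁ * hroot z₂ hz₂ n -
      OPUC.R μ (n + 1) z₂ * hroot z₁ hz₁ n
  · have h1 := hlead 0
    rw [hν.coeff_rPoly_zero, h.coeff_rPoly_succ 1, h.coeff_rPoly_succ 0,
      h.coeff_rPoly_zero] at h1
    rw [hG0, eq_inv_mul_iff_mul_eq₀ hG2]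
    linear_combination h1
  · rintro (_ | m) hm
    · omega
    rw [Nat.add_sub_cancel]
    linear_combination 1 / 2 * hplus m + 1 / 2 * hminus m
  · rintro (_ | m) hm
    · omega
    rw [Nat.add_sub_cancel]
    have h1 := hγ (m + 1)
    refine mul_left_cancel₀ h1 ?_
    rw [show ∀ w : ℂ, γ (m + 1) * (Complex.I / 2 * (γ m / γ (m + 1)) * w) =
      Complex.I / 2 * (γ m * w) from fun w => by field_simp]
    linear_combination Complex.I / 2 * (hminus m) - Complex.I / 2 * (hplus m) +
      γ (m + 1) * OPUC.c (OPUC.christoffel G μ) (m + 1) * Complex.I_mul_I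
  · rintro (_ | m) hm
    · omega
    rw [Nat.add_sub_cancel]
    have h1 : (OPUC.xi (OPUC.christoffel G μ) (m + 1) : ℂ) =
        OPUC.xi (OPUC.christoffel G μ) m * (2 * (1 - OPUC.g (OPUC.christoffel G μ) (m + 1))) := by
      rw [OPUC.xi, Finset.prod_Icc_succ_top (by omega), ← mul_assoc, ← OPUC.xi]
      push_cast
      ring
    have h2 := hxi (m + 1)
    rw [← h2, ← hxi m, h1]
    have h3 := hγ m
    have h4 := hγ (m + 1)
    have h5 := hxi' m
    field_simp
    ring
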